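/- For a group $\Gamma$ and a finite generating set $S$, let $\lambda_S(g)$ be the least $n$ such that $g$ is a product of $n$ elements of $S\cup S^{-1}$, let $\beta_n(S)=|\{g\in\Gamma : \lambda_S(g)\le n\}|$, and let $\beta(S)=\lim_{n\to\infty}\beta_n(S)^{1/n}$ (this limit always exists). A finitely generated group $\Gamma$ has polynomial growth if, for some (equivalently, any) finite generating set $S$, there are constants $C$ and $d$ with $\beta_n(S)\le C n^d$ for all $n\ge 1$. It has uniform exponential growth if $\inf_S \beta(S)>1$, the infimum being over all finite generating sets $S$ of $\Gamma$. Theorem. Let $\Gamma$ be a finitely generated group with a normal subgroup $V$ that is free abelian of finite rank $r\ge 0$ and such that the quotient $\Gamma/V$ is cyclic (finite or infinite). Then $\Gamma$ either has polynomial growth or has uniform exponential growth (and not both). -/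

import Mathlib

open Filter Topology

namespace GroupGrowth

variable {G : Type*} [Group G]

/-- `IsGenWord S l` : every letter of the word `l` lies in `S ∪ S⁻¹`. -/
def IsGenWord (S : Finset G) (l : List G) : Prop :=
  ∀ x ∈ l, x ∈ S ∨ x⁻¹ ∈ S

/-- The word length of `g` with respect to `S`: the least `n` such that `g` is a product of `n`
elements of `S ∪ S⁻¹` (it is `⊤` if `g` is not in the subgroup generated by `S`). -/
noncomputable def wordLength (S : Finset G) (g : G) : ℕ∞ :=
  sInf {k : ℕ∞ | ∃ l : List G, IsGenWord S l ∧ l.prod = g ∧ k = (l.length : ℕ∞)}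

/-- The ball of radius `n` around the identity in the word metric. -/
def wordBall (S : Finset G) (n : ℕ) : Set G :=
  {g | wordLength S g ≤ (n : ℕ∞)}

/-- The growth function: the number of elements of word length at most `n`. -/
noncomputable def growthFunction (S : Finset G) (n : ℕ) : ℕ :=
  (wordBall S n).ncard

/-- The growth rate of `S`: the limit of the `n`-th roots of the growth function. The limit always
exists, see `tendsto_growthRate`. -/
noncomputable def growthRate (S : Finset G) : ℝ :=
  limUnder atTop (fun n : ℕ => (growthFunction S n : ℝ) ^ (1 / (n : ℝ)))

variable (G) in
/-- The finite generating sets of `G`. -/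
abbrev FiniteGeneratingSet : Type _ :=
  {S : Finset G // Subgroup.closure (S : Set G) = ⊤}

variable (G) in
/-- Polynomial growth: for some finite generating set (equivalently, for all of them) the growth
function is bounded by a polynomial. -/
def HasPolynomialGrowth : Prop :=
  ∃ S : FiniteGeneratingSet G, ∃ (C : ℝ) (d : ℕ), ∀ n : ℕ, 1 ≤ n →
    (growthFunction S.1 n : ℝ) ≤ C * (n : ℝ) ^ d

variable (G) in
/-- Uniform exponential growth: the infimum of the growth rates over all finite generating sets is
greater than `1`. (The rates are at least `1`, see `one_le_growthRate`, so the infimum is a genuine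
one as soon as `G` is finitely generated; otherwise it is `0` by convention and the property
fails.) -/
def HasUniformExponentialGrowth : Prop :=
  1 < ⨅ S : FiniteGeneratingSet G, growthRate S.1

theorem mem_wordBall_iff (S : Finset G) (n : ℕ) (g : G) :
    g ∈ wordBall S n ↔ ∃ l : List G, IsGenWord S l ∧ l.prod = g ∧ l.length ≤ n := by
  constructor
  · intro h
    have h' : wordLength S g < ((n + 1 : ℕ) : ℕ∞) :=
      lt_of_le_of_lt h (by exact_mod_cast Nat.lt_succ_self n)
    obtain ⟨k, ⟨l, hl, hg, rfl⟩, hk⟩ := sInf_lt_iff.mp h'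
    exact ⟨l, hl, hg, Nat.lt_succ_iff.mp (by exact_mod_cast hk)⟩
  · rintro ⟨l, hl, hg, hn⟩
    have h : wordLength S g ≤ (l.length : ℕ∞) := sInf_le ⟨l, hl, hg, rfl⟩
    exact h.trans (by exact_mod_cast hn)

theorem one_mem_wordBall (S : Finset G) (n : ℕ) : (1 : G) ∈ wordBall S n :=
  (mem_wordBall_iff S n 1).2 ⟨[], by simp [IsGenWord], rfl, by simp⟩

open Pointwise in
theorem wordBall_add_subset (S : Finset G) (m n : ℕ) :
    wordBall S (m + n) ⊆ wordBall S m * wordBall S n := by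
  intro g hg
  obtain ⟨l, hl, rfl, hn⟩ := (mem_wordBall_iff S _ g).1 hg
  refine ⟨(l.take m).prod, (mem_wordBall_iff S m _).2
      ⟨_, fun x hx => hl x (List.mem_of_mem_take hx), rfl, by simp⟩,
    (l.drop m).prod, (mem_wordBall_iff S n _).2
      ⟨_, fun x hx => hl x (List.mem_of_mem_drop hx), rfl, ?_⟩, ?_⟩
  · simp only [List.length_drop]
    omega
  · simp [← List.prod_append]

theorem finite_wordBall (S : Finset G) (n : ℕ) : (wordBall S n).Finite := by
  have hS : {x : G | x ∈ S ∨ x⁻¹ ∈ S}.Finite := by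
    refine Set.Finite.union S.finite_toSet ?_
    exact Set.Finite.preimage inv_injective.injOn S.finite_toSet
  have := hS.to_subtype
  refine ((List.finite_length_le {x : G | x ∈ S ∨ x⁻¹ ∈ S} n).image
    (fun l => (l.map Subtype.val).prod)).subset ?_
  intro g hg
  obtain ⟨l, hl, rfl, hn⟩ := (mem_wordBall_iff S _ g).1 hg
  refine ⟨l.attach.map (fun x => ⟨x.1, hl x.1 x.2⟩), by simpa using hn, ?_⟩
  simp [Function.comp_def]

theorem one_le_growthFunction (S : Finset G) (n : ℕ) : 1 ≤ growthFunction S n :=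
  (Set.ncard_pos (finite_wordBall S n)).2 ⟨1, one_mem_wordBall S n⟩

open Pointwise in
theorem growthFunction_add_le (S : Finset G) (m n : ℕ) :
    growthFunction S (m + n) ≤ growthFunction S m * growthFunction S n :=
  (Set.ncard_le_ncard (wordBall_add_subset S m n)
    ((finite_wordBall S m).mul (finite_wordBall S n))).trans (by
      simpa [growthFunction, ← Nat.card_coe_set_eq] using
        Set.natCard_mul_le (s := wordBall S m) (t := wordBall S n))

/-- The limit in the definition of the growth rate exists. -/
theorem tendsto_growthRate (S : Finset G) :
    Tendsto (fun n : ℕ => (growthFunction S n : ℝ) ^ (1 / (n : ℝ))) atTop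
      (𝓝 (growthRate S)) := by
  have hpos : ∀ n, (0 : ℝ) < growthFunction S n := fun n => by
    exact_mod_cast one_le_growthFunction S n
  have hsub : Subadditive (fun n : ℕ => Real.log (growthFunction S n)) := by
    intro m n
    rw [← Real.log_mul (hpos m).ne' (hpos n).ne']
    exact Real.log_le_log (hpos _) (by exact_mod_cast growthFunction_add_le S m n)
  have hbdd : BddBelow (Set.range fun n : ℕ => Real.log (growthFunction S n) / n) := by
    refine ⟨0, ?_⟩
    rintro _ ⟨n, rfl⟩
    exact div_nonneg (Real.log_nonneg (by exact_mod_cast one_le_growthFunction S n))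
      n.cast_nonneg
  refine tendsto_nhds_limUnder ⟨Real.exp hsub.lim, ?_⟩
  refine ((Real.continuous_exp.tendsto _).comp (hsub.tendsto_lim hbdd)).congr fun n => ?_
  rw [Function.comp_apply, Real.rpow_def_of_pos (hpos n), mul_one_div]

theorem one_le_growthRate (S : Finset G) : 1 ≤ growthRate S :=
  ge_of_tendsto' (tendsto_growthRate S) fun n =>
    Real.one_le_rpow (by exact_mod_cast one_le_growthFunction S n) (by positivity)

end GroupGrowth

/-! Choose `t` mapping to a generator of Γ/V, so that every element is `u * t ^ m` with `u ∈ V`.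
Conjugation by `t` acts linearly on the finite-dimensional space of characters V → ℂ, and its
eigenvalues decide the growth.

If no eigenvalue of `t` or `t⁻¹` has modulus above 1, matrix coefficients of powers grow
polynomially (`isPolyBounded_pow_apply`). A word of length n then equals `v * t ^ m` with |m| ≤ n
and with the coordinates of `v` polynomial in n; counting these pairs gives polynomial growth.

Otherwise, after possibly replacing `t` by `t⁻¹`, some character f ≠ 0 is multiplied by c with |c| >
1. In any generating set S, two elements have a commutator v with f(v) ≠ 0
(`exists_commutator_ne_zero`). One of them acts on f by a nontrivial power of c, so a p-th power g
of it or of its inverse contracts f by at least half, where p depends only on c. Digit expansions in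
base less than 1/2 show that g and g * v generate a free semigroup (`two_pow_le_growthFunction`).
Both have length at most p + 4, so β(S) ≥ 2^(1/(p+4)) for every S. -/

namespace GroupGrowth

/-! ### Polynomially bounded sequences and matrix powers -/

/-- A sequence of complex numbers is polynomially bounded. -/
def IsPolyBounded (u : ℕ → ℂ) : Prop :=
  ∃ d : ℕ, ∀ n : ℕ, ‖u n‖ ≤ ((n : ℝ) + 2) ^ d

theorem pow_le_pow_of_le_exponent (n : ℕ) {d e : ℕ} (h : d ≤ e) :
    ((n : ℝ) + 2) ^ d ≤ ((n : ℝ) + 2) ^ e :=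
  pow_le_pow_right₀ (by linarith [n.cast_nonneg (α := ℝ)]) h

/-- Since n + 2 ≥ 2 even at n = 0, constants are absorbed into the exponent; this is why
`IsPolyBounded` carries no constant factor. -/
theorem exists_le_pow (c : ℝ) : ∃ k : ℕ, ∀ n : ℕ, c ≤ ((n : ℝ) + 2) ^ k := by
  obtain ⟨k, hk⟩ := pow_unbounded_of_one_lt c (one_lt_two : (1 : ℝ) < 2)
  exact ⟨k, fun n => hk.le.trans
    (pow_le_pow_left₀ zero_le_two (by linarith [n.cast_nonneg (α := ℝ)]) k)⟩

theorem IsPolyBounded.add {u v : ℕ → ℂ} (hu : IsPolyBounded u) (hv : IsPolyBounded v) :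
    IsPolyBounded (u + v) := by
  obtain ⟨d, hd⟩ := hu
  obtain ⟨e, he⟩ := hv
  refine ⟨max d e + 1, fun n => (norm_add_le _ _).trans ?_⟩
  have h₁ := (hd n).trans (pow_le_pow_of_le_exponent n (le_max_left d e))
  have h₂ := (he n).trans (pow_le_pow_of_le_exponent n (le_max_right d e))
  have h₃ : (0 : ℝ) ≤ ((n : ℝ) + 2) ^ max d e := by positivity
  rw [pow_succ]
  nlinarith [n.cast_nonneg (α := ℝ)]

theorem IsPolyBounded.const_smul {u : ℕ → ℂ} (hu : IsPolyBounded u) (c : ℂ) :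
    IsPolyBounded (c • u) := by
  obtain ⟨d, hd⟩ := hu
  obtain ⟨k, hk⟩ := exists_le_pow ‖c‖
  refine ⟨k + d, fun n => ?_⟩
  rw [Pi.smul_apply, norm_smul, pow_add]
  exact mul_le_mul (hk n) (hd n) (norm_nonneg _) (by positivity)

/-- A solution of `u (n + 1) = c * u n + v n` with `‖c‖ ≤ 1` and `v` polynomially bounded is
polynomially bounded. -/
theorem IsPolyBounded.of_recurrence {u v : ℕ → ℂ} {c : ℂ} (hc : ‖c‖ ≤ 1) (hv : IsPolyBounded v)
    (h : ∀ n, u (n + 1) = c * u n + v n) : IsPolyBounded u := by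
  obtain ⟨d, hd⟩ := hv
  obtain ⟨k, hk⟩ := exists_le_pow ‖u 0‖
  refine ⟨max d k + 1, fun n => ?_⟩
  -- As ‖c‖ ≤ 1, `u n` is bounded by the initial value plus n earlier terms of `v`: n + 1
  -- contributions, each at most the common power.
  have key : ‖u n‖ ≤ ((n : ℝ) + 1) * ((n : ℝ) + 2) ^ max d k := by
    induction n with
    | zero =>
      simpa using (hk 0).trans (pow_le_pow_of_le_exponent 0 (le_max_right d k))
    | succ n ih =>
      have h₁ : ‖u (n + 1)‖ ≤ ‖u n‖ + ‖v n‖ := by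
        rw [h]
        refine (norm_add_le _ _).trans (add_le_add_left ?_ _)
        rw [norm_mul]
        exact mul_le_of_le_one_left (norm_nonneg _) hc
      have h₂ := (hd n).trans (pow_le_pow_of_le_exponent n (le_max_left d k))
      have h₃ : ((n : ℝ) + 2) ^ max d k ≤ (((n + 1 : ℕ) : ℝ) + 2) ^ max d k :=
        pow_le_pow_left₀ (by positivity) (by push_cast; linarith) _
      calc ‖u (n + 1)‖ ≤ ((n : ℝ) + 2) * ((n : ℝ) + 2) ^ max d k := by linarith
        _ ≤ ((n : ℝ) + 2) * (((n + 1 : ℕ) : ℝ) + 2) ^ max d k := by gcongr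
        _ = _ := by push_cast; ring
  refine key.trans ?_
  rw [pow_succ, mul_comm]
  gcongr
  norm_num

/-- If all eigenvalues of `T` lie in the closed unit disc, the matrix coefficients of the powers
of `T` are polynomially bounded. -/
theorem isPolyBounded_pow_apply {E : Type*} [AddCommGroup E] [Module ℂ E]
    [FiniteDimensional ℂ E] (T : Module.End ℂ E) (hT : ∀ c, T.HasEigenvalue c → ‖c‖ ≤ 1)
    (φ : E →ₗ[ℂ] ℂ) (x : E) : IsPolyBounded fun n => φ ((T ^ n) x) := by
  let P : Submodule ℂ E :=
    { carrier := {x | IsPolyBounded fun n => φ ((T ^ n) x)}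
      add_mem' := fun {a b} ha hb => by
        simpa [Pi.add_def] using IsPolyBounded.add ha hb
      zero_mem' := ⟨0, fun n => by simp⟩
      smul_mem' := fun c a ha => by
        simpa [Pi.smul_def] using IsPolyBounded.const_smul ha c }
  -- Over ℂ the generalized eigenspaces span. Within one, induct on the order k of nilpotency of T -
  -- c: the sequence of y obeys a recurrence whose inhomogeneous term is the sequence of (T - c) y,
  -- of lower order.
  suffices h : ⨆ c, T.maxGenEigenspace c ≤ P by
    rw [Module.End.iSup_maxGenEigenspace_eq_top] at h
    exact h (Submodule.mem_top (x := x))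
  refine iSup_le fun c y hy => ?_
  obtain ⟨k, hk⟩ := (Module.End.mem_maxGenEigenspace T c y).1 hy
  by_cases hc : T.HasEigenvalue c
  · induction k generalizing y with
    | zero =>
      have : y = 0 := by simpa using hk
      exact this ▸ P.zero_mem
    | succ k ih =>
      have hz : (T - c • (1 : Module.End ℂ E)) y ∈ P := by
        refine ih _ ?_ ?_
        · exact (Module.End.mem_maxGenEigenspace T c _).2 ⟨k, by
            rwa [← Module.End.mul_apply, ← pow_succ]⟩
        · rwa [← Module.End.mul_apply, ← pow_succ]
      refine IsPolyBounded.of_recurrence (hT c hc) hz fun n => ?_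
      simp only [LinearMap.sub_apply, LinearMap.smul_apply, Module.End.one_apply, map_sub,
        map_smul, smul_eq_mul, pow_succ, Module.End.mul_apply]
      ring
  · have h0 : T.maxGenEigenspace c = ⊥ := by
      by_contra hne
      refine hc ?_
      obtain ⟨z, hz, hz0⟩ := Submodule.exists_mem_ne_zero_of_ne_bot hne
      obtain ⟨j, hj⟩ := (Module.End.mem_maxGenEigenspace T c z).1 hz
      refine Module.End.hasEigenvalue_of_hasGenEigenvalue (k := j) ?_
      rw [Module.End.hasGenEigenvalue_iff]
      refine fun hb => hz0 ?_
      have hm : z ∈ T.genEigenspace c j := by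
        rw [Module.End.mem_genEigenspace_nat]
        simpa using hj
      simpa [hb] using hm
    rw [h0] at hy
    exact (Submodule.mem_bot ℂ).1 hy ▸ P.zero_mem

/-! ### Growth rates -/

variable {G : Type*} [Group G]

theorem mul_mem_wordBall {S : Finset G} {m n : ℕ} {g h : G} (hg : g ∈ wordBall S m)
    (hh : h ∈ wordBall S n) : g * h ∈ wordBall S (m + n) := by
  obtain ⟨l, hl, rfl, hn⟩ := (mem_wordBall_iff S _ _).1 hg
  obtain ⟨l', hl', rfl, hn'⟩ := (mem_wordBall_iff S _ _).1 hh
  refine (mem_wordBall_iff S _ _).2 ⟨l ++ l', fun x hx => ?_, by simp, by simp; omega⟩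
  exact (List.mem_append.1 hx).elim (hl x) (hl' x)

theorem mem_wordBall_one {S : Finset G} {g : G} (hg : g ∈ S ∨ g⁻¹ ∈ S) : g ∈ wordBall S 1 :=
  (mem_wordBall_iff S _ _).2 ⟨[g], by simpa [IsGenWord] using hg, by simp, by simp⟩

theorem pow_mem_wordBall {S : Finset G} {m : ℕ} {g : G} (hg : g ∈ wordBall S m) (n : ℕ) :
    g ^ n ∈ wordBall S (n * m) := by
  induction n with
  | zero => simpa using one_mem_wordBall S _
  | succ n ih => rw [pow_succ, Nat.succ_mul]; exact mul_mem_wordBall ih hg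

theorem commutator_mem_wordBall {S : Finset G} {a b : G} (ha : a ∈ S) (hb : b ∈ S) :
    a * b * a⁻¹ * b⁻¹ ∈ wordBall S 4 :=
  mul_mem_wordBall (mul_mem_wordBall (mul_mem_wordBall (mem_wordBall_one (.inl ha))
    (mem_wordBall_one (.inl hb))) (mem_wordBall_one (.inr (by simpa using ha))))
    (mem_wordBall_one (.inr (by simpa using hb)))

/-- A group with polynomial growth does not have uniform exponential growth. -/
theorem HasPolynomialGrowth.not_hasUniformExponentialGrowth (h : HasPolynomialGrowth G) :
    ¬ HasUniformExponentialGrowth G := by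
  obtain ⟨S, C, d, hS⟩ := h
  refine fun h' => absurd h' (not_lt.2 ?_)
  refine (ciInf_le ⟨1, ?_⟩ S).trans ?_
  · rintro _ ⟨T, rfl⟩
    exact one_le_growthRate _
  have hC : 0 < C := by
    have := hS 1 le_rfl
    have h1 : (1 : ℝ) ≤ growthFunction S.1 1 := by exact_mod_cast one_le_growthFunction S.1 1
    simp at this
    linarith
  have h1 : Tendsto (fun n : ℕ => C ^ (1 / (n : ℝ))) atTop (𝓝 1) := by
    have := (Real.continuousAt_const_rpow hC.ne' (b := 0)).tendsto.comp
      (tendsto_one_div_atTop_nhds_zero_nat (𝕜 := ℝ))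
    simpa [Function.comp_def] using this
  have h2 : Tendsto (fun n : ℕ => ((n : ℝ) ^ (1 / (n : ℝ))) ^ d) atTop (𝓝 1) := by
    simpa [Function.comp_def] using (tendsto_rpow_div.comp tendsto_natCast_atTop_atTop).pow d
  refine le_of_tendsto_of_tendsto (tendsto_growthRate S.1) (by simpa using h1.mul h2) ?_
  filter_upwards [eventually_ge_atTop 1] with n hn
  refine (Real.rpow_le_rpow (by positivity) (hS n hn) (by positivity)).trans_eq ?_
  rw [Real.mul_rpow hC.le (by positivity), ← Real.rpow_natCast, ← Real.rpow_natCast,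
    ← Real.rpow_mul (by positivity), ← Real.rpow_mul (by positivity), mul_comm (d : ℝ)]
  simp only [one_div]

/-- A lower bound for the growth rate from exponentially many elements in the balls. -/
theorem le_growthRate_of_two_pow_le {S : Finset G} {k : ℕ} (hk : 0 < k)
    (h : ∀ n, 2 ^ n ≤ growthFunction S (n * k)) : (2 : ℝ) ^ (1 / (k : ℝ)) ≤ growthRate S := by
  have hsub : Tendsto (fun n : ℕ => n * k) atTop atTop :=
    tendsto_id.atTop_mul_const' hk
  refine ge_of_tendsto ((tendsto_growthRate S).comp hsub) ?_
  filter_upwards [eventually_ge_atTop 1] with n hn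
  have hn' : (n : ℝ) ≠ 0 := by positivity
  have hk' : (k : ℝ) ≠ 0 := by positivity
  calc (2 : ℝ) ^ (1 / (k : ℝ)) = ((2 : ℝ) ^ n) ^ (1 / ((n * k : ℕ) : ℝ)) := by
        rw [← Real.rpow_natCast, ← Real.rpow_mul zero_le_two]
        congr 1
        push_cast
        field_simp
    _ ≤ _ := Real.rpow_le_rpow (by positivity) (by exact_mod_cast h n) (by positivity)

/-! ### Characters of a normal abelian subgroup and uniform exponential growth -/

/-- Conjugation by `g` multiplies the additive character `f` of the normal subgroup `V` by `c`. -/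
def HasMultiplier {V : Subgroup G} [V.Normal] (f : Additive V →+ ℂ) (g : G) (c : ℂ) : Prop :=
  ∀ v : V, f (.ofMul (MulAut.conjNormal g v)) = c * f (.ofMul v)

namespace HasMultiplier

variable {V : Subgroup G} [V.Normal] {f : Additive V →+ ℂ} {g h : G} {b c : ℂ}

theorem one : HasMultiplier f 1 1 := fun v => by simp

theorem mul (hg : HasMultiplier f g b) (hh : HasMultiplier f h c) :
    HasMultiplier f (g * h) (b * c) := fun v => by
  rw [map_mul, MulAut.mul_apply, hg, hh, mul_assoc]

theorem inv (hg : HasMultiplier f g c) (hc : c ≠ 0) : HasMultiplier f g⁻¹ c⁻¹ := fun v => by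
  rw [eq_inv_mul_iff_mul_eq₀ hc, ← hg, ← MulAut.mul_apply, ← map_mul]
  simp

theorem pow (hg : HasMultiplier f g c) (n : ℕ) : HasMultiplier f (g ^ n) (c ^ n) := by
  induction n with
  | zero => simpa using one
  | succ n ih => simpa only [pow_succ] using ih.mul hg

theorem zpow (hg : HasMultiplier f g c) (hc : c ≠ 0) (n : ℤ) :
    HasMultiplier f (g ^ n) (c ^ n) := by
  obtain ⟨n, rfl | rfl⟩ := n.eq_nat_or_neg
  · simpa using hg.pow n
  · simpa using (hg.pow n).inv (pow_ne_zero n hc)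

theorem of_mem [IsMulCommutative V] (hg : g ∈ V) : HasMultiplier f g 1 := fun v => by
  have : MulAut.conjNormal g v = v := by
    ext
    rw [MulAut.conjNormal_apply]
    have := congrArg Subtype.val ((IsMulCommutative.is_comm (M := V)).comm ⟨g, hg⟩ v)
    simp only [Subgroup.coe_mul] at this
    rw [this, mul_inv_cancel_right]
  rw [this, one_mul]

end HasMultiplier

/-- The value of a sequence of binary digits in the expansion with base `c` and unit `a`. -/
noncomputable def digitSum (c a : ℂ) : List Bool → ℂ
  | [] => 0
  | b :: l => c * ((if b then a else 0) + digitSum c a l)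

/-- Adding a leading digit turns a difference d into c (ε + d) with ‖ε‖ ≤ ‖a‖, so ‖d‖ < ‖a‖ is
preserved when ‖c‖ ≤ 1/2. -/
theorem norm_digitSum_sub_lt {c a : ℂ} (hc : ‖c‖ ≤ 1 / 2) (ha : a ≠ 0) :
    ∀ l l' : List Bool, l.length = l'.length → ‖digitSum c a l - digitSum c a l'‖ < ‖a‖
  | [], [], _ => by simpa [digitSum] using ha
  | [], _ :: _, h => by simp at h
  | _ :: _, [], h => by simp at h
  | b :: l, b' :: l', h => by
    have ih := norm_digitSum_sub_lt hc ha l l' (by simpa using h)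
    have hb : ‖(if b then a else 0) - (if b' then a else 0)‖ ≤ ‖a‖ := by
      cases b <;> cases b' <;> simp
    have hsum : ‖((if b then a else 0) - (if b' then a else 0)) +
        (digitSum c a l - digitSum c a l')‖ < 2 * ‖a‖ :=
      (norm_add_le _ _).trans_lt (by linarith)
    calc ‖digitSum c a (b :: l) - digitSum c a (b' :: l')‖
        = ‖c‖ * ‖((if b then a else 0) - (if b' then a else 0)) +
          (digitSum c a l - digitSum c a l')‖ := by
          rw [← norm_mul]
          simp only [digitSum]
          ring_nf
      _ ≤ 1 / 2 * ‖((if b then a else 0) - (if b' then a else 0)) +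
          (digitSum c a l - digitSum c a l')‖ := by gcongr
      _ < ‖a‖ := by linarith

/-- Different leading digits would have to be compensated by tails differing by exactly `a` in norm,
which the strict bound forbids. -/
theorem digitSum_inj {c a : ℂ} (hc : ‖c‖ ≤ 1 / 2) (hc0 : c ≠ 0) (ha : a ≠ 0) :
    ∀ l l' : List Bool, l.length = l'.length → digitSum c a l = digitSum c a l' → l = l'
  | [], [], _, _ => rfl
  | [], _ :: _, h, _ => by simp at h
  | _ :: _, [], h, _ => by simp at h
  | b :: l, b' :: l', h, heq => by
    have hlen : l.length = l'.length := by simpa using h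
    have hlt := norm_digitSum_sub_lt hc ha l l' hlen
    have heq' := mul_left_cancel₀ hc0 heq
    have hbb : b = b' := by
      cases b <;> cases b' <;> simp only [if_true, if_false, Bool.false_eq_true, zero_add] at heq'
      · rfl
      · rw [heq', add_sub_cancel_right] at hlt
        exact absurd hlt (lt_irrefl _)
      · rw [← heq', sub_add_cancel_right, norm_neg] at hlt
        exact absurd hlt (lt_irrefl _)
      · rfl
    subst hbb
    rw [digitSum_inj hc hc0 ha l l' hlen (add_left_cancel heq')]

/-- If `g` contracts the character `f` at least by half and `f v ≠ 0`, the elements `g` and `g * v`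
freely generate a free semigroup. -/
theorem two_pow_le_growthFunction {V : Subgroup G} [V.Normal] {f : Additive V →+ ℂ} {g : G}
    {c : ℂ} (hg : HasMultiplier f g c) (hc : ‖c‖ ≤ 1 / 2) (hc0 : c ≠ 0) {v : V}
    (hv : f (.ofMul v) ≠ 0) {S : Finset G} {p q : ℕ} (hgS : g ∈ wordBall S p)
    (hvS : (v : G) ∈ wordBall S q) (n : ℕ) : 2 ^ n ≤ growthFunction S (n * (p + q)) := by
  let W : List Bool → G := fun l => (l.map fun b => g * (if b then (v : G) else 1)).prod
  -- Moving every `g` to the right conjugates the factors `v`, and f turns this into a Horner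
  -- expansion in base c. For words of equal length the power of `g` cancels, so the digits can be
  -- recovered from the product.
  have hW : ∀ l, ∃ x : V, W l = x * g ^ l.length ∧
      f (.ofMul x) = digitSum c (f (.ofMul v)) l := by
    intro l
    induction l with
    | nil => exact ⟨1, by simp [W], by simp [digitSum]⟩
    | cons b l ih =>
      obtain ⟨x, hx, hfx⟩ := ih
      refine ⟨MulAut.conjNormal g ((if b then v else 1) * x), ?_, ?_⟩
      · have : W (b :: l) = g * (if b then (v : G) else 1) * W l := by simp [W]
        rw [this, hx, MulAut.conjNormal_apply, List.length_cons, pow_succ']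
        cases b <;> simp [mul_assoc]
      · rw [hg, ofMul_mul, map_add, hfx, digitSum]
        cases b <;> simp
  have hinj : Function.Injective fun w : Fin n → Bool => W (List.ofFn w) := by
    intro w w' h
    obtain ⟨x, hx, hfx⟩ := hW (List.ofFn w)
    obtain ⟨x', hx', hfx'⟩ := hW (List.ofFn w')
    have hxx : x = x' := by
      have h' : W (List.ofFn w) = W (List.ofFn w') := h
      rw [hx, hx', List.length_ofFn, List.length_ofFn] at h'
      exact Subtype.ext (mul_right_cancel h')
    subst hxx
    exact List.ofFn_injective
      (digitSum_inj hc hc0 hv _ _ (by simp) (hfx.symm.trans hfx'))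
  have hball : ∀ l, W l ∈ wordBall S (l.length * (p + q)) := by
    intro l
    induction l with
    | nil => exact one_mem_wordBall S _
    | cons b l ih =>
      have : W (b :: l) = g * (if b then (v : G) else 1) * W l := by simp [W]
      rw [this, List.length_cons, Nat.succ_mul, add_comm (l.length * _)]
      refine mul_mem_wordBall (mul_mem_wordBall hgS ?_) ih
      cases b
      · exact one_mem_wordBall S _
      · exact hvS
  calc 2 ^ n = (Set.range fun w : Fin n → Bool => W (List.ofFn w)).ncard := by
        rw [← Nat.card_coe_set_eq, Nat.card_range_of_injective hinj]
        simp
    _ ≤ _ := Set.ncard_le_ncard (by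
        rintro _ ⟨w, rfl⟩
        simpa using hball (List.ofFn w)) (finite_wordBall _ _)

/-- If the character `f` is not invariant under conjugation by `t`, every generating set contains
two elements whose commutator lies in `V` and is not killed by `f`. -/
theorem exists_commutator_ne_zero {V : Subgroup G} [V.Normal] [IsMulCommutative V]
    {f : Additive V →+ ℂ} (hf : f ≠ 0) {t : G} {c : ℂ} (ht : HasMultiplier f t c) (hc0 : c ≠ 0)
    (hc1 : c ≠ 1) (htop : ∀ g : G, ∃ (m : ℤ) (u : V), g = u * t ^ m) {S : Finset G}
    (hS : Subgroup.closure (S : Set G) = ⊤) :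
    ∃ a ∈ S, ∃ b ∈ S, ∃ v : V, (v : G) = a * b * a⁻¹ * b⁻¹ ∧ f (.ofMul v) ≠ 0 := by
  have hcomm : ∀ a b : G, a * b * a⁻¹ * b⁻¹ ∈ V := by
    intro a b
    rw [← QuotientGroup.eq_one_iff]
    obtain ⟨m, u, rfl⟩ := htop a
    obtain ⟨n, w, rfl⟩ := htop b
    have hu : ((u : G) : G ⧸ V) = 1 := (QuotientGroup.eq_one_iff _).2 u.2
    have hw : ((w : G) : G ⧸ V) = 1 := (QuotientGroup.eq_one_iff _).2 w.2
    simp only [QuotientGroup.mk_mul, QuotientGroup.mk_inv, QuotientGroup.mk_zpow, hu, hw, one_mul]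
    rw [← zpow_add, add_comm, zpow_add, mul_inv_cancel_right, mul_inv_cancel]
  by_contra! H
  -- The kernel of f, seen in G, is normal because conjugation only rescales f. If f kills all
  -- commutators of generators, G/K is abelian.
  let K : Subgroup G := f.ker.toSubgroup'.map V.subtype
  have hK : ∀ v : V, (v : G) ∈ K ↔ f (.ofMul v) = 0 := by
    intro v
    constructor
    · rintro ⟨w, hw, hwv⟩
      rwa [← (Subtype.ext hwv : w = v)]
    · exact fun h => ⟨v, h, rfl⟩
  have hKV : K ≤ V := by
    rintro _ ⟨w, -, rfl⟩
    exact w.2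
  have hKn : K.Normal := by
    refine ⟨fun x hx g => ?_⟩
    obtain ⟨m, u, rfl⟩ := htop g
    have h := (HasMultiplier.of_mem (f := f) u.2).mul (ht.zpow hc0 m) ⟨x, hKV hx⟩
    rw [(hK ⟨x, hKV hx⟩).1 hx, mul_zero] at h
    simpa only [MulAut.conjNormal_apply] using (hK _).2 h
  have hquot : ∀ a b : G, a * b * a⁻¹ * b⁻¹ ∈ K := by
    have hgen : ∀ a ∈ S, ∀ b ∈ S, a * b * a⁻¹ * b⁻¹ ∈ K := fun a ha b hb =>
      (hK ⟨_, hcomm a b⟩).2 (H a ha b hb _ rfl)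
    have hcl : Subgroup.closure ((QuotientGroup.mk' K) '' (S : Set G)) = ⊤ := by
      rw [← MonoidHom.map_closure, hS, ← MonoidHom.range_eq_map]
      exact MonoidHom.range_eq_top.2 (QuotientGroup.mk'_surjective K)
    have hcm := Subgroup.isMulCommutative_closure (k := (QuotientGroup.mk' K) '' (S : Set G)) (by
      rintro _ ⟨a, ha, rfl⟩ _ ⟨b, hb, rfl⟩
      have := (QuotientGroup.eq_one_iff (N := K) _).2 (hgen a ha b hb)
      simp only [QuotientGroup.mk_mul, QuotientGroup.mk_inv] at this
      rw [mul_inv_eq_one, mul_inv_eq_iff_eq_mul] at this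
      exact this)
    intro a b
    have hab := congrArg Subtype.val (hcm.is_comm.comm
      ⟨(a : G ⧸ K), hcl ▸ Subgroup.mem_top _⟩ ⟨(b : G ⧸ K), hcl ▸ Subgroup.mem_top _⟩)
    rw [← QuotientGroup.eq_one_iff]
    simp only [QuotientGroup.mk_mul, QuotientGroup.mk_inv]
    rw [mul_inv_eq_one, mul_inv_eq_iff_eq_mul]
    exact hab
  refine hf (AddMonoidHom.ext fun v => ?_)
  -- The commutator of `t` and `v` lies in K, so (c - 1) f(v) = 0, although c ≠ 1.
  have h := (hK (MulAut.conjNormal t v.toMul * (v.toMul)⁻¹)).1 (by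
    simpa using hquot t v.toMul)
  rw [ofMul_mul, map_add, ht, ofMul_inv, map_neg, ofMul_toMul, ← sub_eq_add_neg,
    ← sub_one_mul] at h
  simpa [sub_ne_zero.2 hc1] using h

theorem hasUniformExponentialGrowth_of_multiplier [Group.FG G] {V : Subgroup G} [V.Normal]
    [IsMulCommutative V] {f : Additive V →+ ℂ} (hf : f ≠ 0) {t : G} {c : ℂ}
    (ht : HasMultiplier f t c) (hc : 1 < ‖c‖) (htop : ∀ g : G, ∃ (m : ℤ) (u : V), g = u * t ^ m) :
    HasUniformExponentialGrowth G := by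
  have hc0 : c ≠ 0 := by
    rintro rfl
    simp at hc
    linarith
  have hc1 : c ≠ 1 := by
    rintro rfl
    simp at hc
  -- p is fixed before S is introduced; this makes the final bound uniform.
  obtain ⟨p, hp⟩ := exists_pow_lt_of_lt_one (by norm_num : (0 : ℝ) < 1 / 2) (inv_lt_one_of_one_lt₀ hc)
  -- Over an empty family the infimum would be 0 by default.
  have hnon : Nonempty (FiniteGeneratingSet G) := by
    obtain ⟨-, S, -, hS⟩ := Group.fg_iff'.1 ‹Group.FG G›
    exact ⟨⟨S, hS⟩⟩
  refine (Real.one_lt_rpow one_lt_two (by positivity : 0 < 1 / ((p + 4 : ℕ) : ℝ))).trans_le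
    (le_ciInf fun S => ?_)
  refine le_growthRate_of_two_pow_le (by omega) ?_
  obtain ⟨a, ha, b, hb, v, hv, hfv⟩ := exists_commutator_ne_zero hf ht hc0 hc1 htop S.2
  -- If both exponents of `t` vanished, a and b would lie in the abelian group V and v would be
  -- trivial.
  obtain ⟨g, hg, m, hm, hgm⟩ : ∃ g ∈ S.1, ∃ m : ℤ, m ≠ 0 ∧ HasMultiplier f g (c ^ m) := by
    obtain ⟨m, u, hu⟩ := htop a
    obtain ⟨n, w, hw⟩ := htop b
    by_cases hm : m = 0
    · by_cases hn : n = 0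
      · refine absurd ?_ hfv
        have : v = 1 := by
          ext
          have huw := congrArg Subtype.val ((IsMulCommutative.is_comm (M := V)).comm u w)
          simp only [Subgroup.coe_mul] at huw
          rw [hv, hu, hw, hm, hn, zpow_zero, mul_one, mul_one, huw, mul_inv_cancel_right,
            mul_inv_cancel, Subgroup.coe_one]
        rw [this, ofMul_one, map_zero]
      · refine ⟨b, hb, n, hn, ?_⟩
        simpa [hw] using (HasMultiplier.of_mem (f := f) w.2).mul (ht.zpow hc0 n)
    · refine ⟨a, ha, m, hm, ?_⟩
      simpa [hu] using (HasMultiplier.of_mem (f := f) u.2).mul (ht.zpow hc0 m)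
  -- Inverting g when m > 0 makes the multiplier a contraction at no cost in length.
  obtain ⟨h, hh, k, hk, hhk⟩ : ∃ h ∈ wordBall S.1 1, ∃ k : ℕ, 1 ≤ k ∧
      HasMultiplier f h (c⁻¹ ^ k) := by
    obtain ⟨k, rfl | rfl⟩ := m.eq_nat_or_neg
    · refine ⟨g⁻¹, mem_wordBall_one (.inr (by simpa using hg)), k, by omega, ?_⟩
      simpa using hgm.inv (zpow_ne_zero _ hc0)
    · exact ⟨g, mem_wordBall_one (.inl hg), k, by omega, by simpa using hgm⟩
  refine two_pow_le_growthFunction (hhk.pow p) ?_ (by simp [hc0]) hfv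
    (by simpa using pow_mem_wordBall hh p) (hv ▸ commutator_mem_wordBall ha hb)
  rw [← pow_mul, norm_pow, norm_inv]
  exact (pow_le_pow_of_le_one (by positivity) (inv_le_one_of_one_le₀ hc.le)
    (Nat.le_mul_of_pos_left p hk)).trans hp.le

/-! ### The action by conjugation on characters -/

/-- The action of `g` by conjugation on the additive complex characters of `V`. -/
noncomputable def conjEnd (V : Subgroup G) [V.Normal] (g : G) :
    Module.End ℂ (Additive V →+ ℂ) where
  toFun f := f.comp (MonoidHom.toAdditive (MulAut.conjNormal g).toMonoidHom)
  map_add' _ _ := rfl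
  map_smul' _ _ := rfl

theorem conjEnd_apply {V : Subgroup G} [V.Normal] (g : G) (f : Additive V →+ ℂ) (v : V) :
    conjEnd V g f (.ofMul v) = f (.ofMul (MulAut.conjNormal g v)) := rfl

theorem conjEnd_pow_apply {V : Subgroup G} [V.Normal] (g : G) (f : Additive V →+ ℂ) (v : V)
    (n : ℕ) : (conjEnd V g ^ n) f (.ofMul v) = f (.ofMul (MulAut.conjNormal (g ^ n) v)) := by
  induction n generalizing f with
  | zero => simp
  | succ n ih => rw [pow_succ, Module.End.mul_apply, ih, conjEnd_apply, pow_succ', map_mul,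
      MulAut.mul_apply]

/-- A character is determined by its values on a basis of ℤ^r. -/
theorem finiteDimensional_characters {A : Type*} [AddGroup A] {r : ℕ} (e : A ≃+ (Fin r → ℤ)) :
    FiniteDimensional ℂ (A →+ ℂ) := by
  let L : (A →+ ℂ) →ₗ[ℂ] (Fin r → ℂ) :=
    { toFun := fun f i => f (e.symm (Pi.single i 1))
      map_add' := fun _ _ => rfl
      map_smul' := fun _ _ => rfl }
  refine FiniteDimensional.of_injective L fun f f' h => ?_
  have h' : f.comp e.symm.toAddMonoidHom = f'.comp e.symm.toAddMonoidHom := by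
    refine AddMonoidHom.functions_ext _ _ _ fun i n => ?_
    have : (Pi.single i n : Fin r → ℤ) = n • Pi.single i 1 := by simp [← Pi.single_smul]
    rw [this, map_zsmul, map_zsmul]
    exact congrArg (n • ·) (congrFun h i)
  ext v
  simpa using DFunLike.congr_fun h' (e v)

/-- If all eigenvalues of the conjugation by `g` on characters lie in the closed unit disc, the
characters grow polynomially along the orbits of `g`. -/
theorem isPolyBounded_conj {V : Subgroup G} [V.Normal] [FiniteDimensional ℂ (Additive V →+ ℂ)]
    {g : G} (hg : ∀ c, (conjEnd V g).HasEigenvalue c → ‖c‖ ≤ 1) (f : Additive V →+ ℂ) (v : V) :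
    IsPolyBounded fun n => f (.ofMul (MulAut.conjNormal (g ^ n) v)) := by
  let ev : (Additive V →+ ℂ) →ₗ[ℂ] ℂ :=
    { toFun := fun f => f (.ofMul v)
      map_add' := fun _ _ => rfl
      map_smul' := fun _ _ => rfl }
  have h := isPolyBounded_pow_apply (conjEnd V g) hg ev f
  have hev : ∀ n, ev ((conjEnd V g ^ n) f) = f (.ofMul (MulAut.conjNormal (g ^ n) v)) :=
    fun n => conjEnd_pow_apply g f v n
  simpa only [hev] using h

/-! ### Polynomial growth -/

/-- Counting with coordinates: polynomial growth from a polynomial bound on the coordinates of the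
elements represented by words. -/
theorem hasPolynomialGrowth_of_coordinates {V : Subgroup G} {r : ℕ}
    (e : Additive V ≃+ (Fin r → ℤ)) {t : G} {S : Finset G}
    (hS : Subgroup.closure (S : Set G) = ⊤) (d : ℕ)
    (h : ∀ l : List G, IsGenWord S l → ∃ (v : V) (m : ℤ), l.prod = v * t ^ m ∧
      m.natAbs ≤ l.length ∧
      ∀ i, (e (.ofMul v) i).natAbs ≤ l.length * (l.length + 2) ^ d) :
    HasPolynomialGrowth G := by
  refine ⟨⟨S, hS⟩, (((3 ^ (d + 1)) ^ r * 3 : ℕ) : ℝ), (d + 1) * r + 1, fun n hn => ?_⟩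
  let N : ℤ := ((n * (n + 2) ^ d : ℕ) : ℤ)
  let B : Finset ((Fin r → ℤ) × ℤ) :=
    Finset.Icc (fun _ => -N) (fun _ => N) ×ˢ Finset.Icc (-(n : ℤ)) n
  -- Only covering the ball by the image of a box matters: F need not be injective, for instance
  -- when the quotient by V is finite.
  let F : (Fin r → ℤ) × ℤ → G := fun x => ((e.symm x.1).toMul : V) * t ^ x.2
  have hsub : wordBall S n ⊆ F '' (B : Set ((Fin r → ℤ) × ℤ)) := by
    intro g hg
    obtain ⟨l, hl, rfl, hln⟩ := (mem_wordBall_iff S n g).1 hg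
    obtain ⟨v, m, hvm, hm, hv⟩ := h l hl
    refine ⟨(e (.ofMul v), m), ?_, by simp [F, hvm]⟩
    have hv' : ∀ i, |e (.ofMul v) i| ≤ N := fun i => by
      rw [Int.abs_eq_natAbs]
      refine Int.ofNat_le.2 ((hv i).trans ?_)
      gcongr
    simp only [B, Finset.coe_product, Set.mem_prod, Finset.coe_Icc, Set.mem_Icc, Pi.le_def]
    refine ⟨⟨fun i => (abs_le.1 (hv' i)).1, fun i => (abs_le.1 (hv' i)).2⟩, ?_, ?_⟩ <;> omega
  have hcard : B.card = (2 * (n * (n + 2) ^ d) + 1) ^ r * (2 * n + 1) := by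
    have h₁ : ∀ k : ℕ, ((k : ℤ) + 1 - -(k : ℤ)).toNat = 2 * k + 1 := fun k => by omega
    rw [Finset.card_product, Pi.card_Icc]
    simp only [N, Int.card_Icc, h₁, Finset.prod_const, Finset.card_univ, Fintype.card_fin]
  have hle : growthFunction S n ≤ B.card := by
    refine (Set.ncard_le_ncard hsub (B.finite_toSet.image F)).trans ?_
    refine (Set.ncard_image_le B.finite_toSet).trans_eq (Set.ncard_coe_finset B)
  have hpow : 2 * (n * (n + 2) ^ d) + 1 ≤ 3 ^ (d + 1) * n ^ (d + 1) := by
    have h₁ : (n + 2) ^ d ≤ (3 * n) ^ d := Nat.pow_le_pow_left (by omega) d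
    have h₂ : 1 ≤ n * (3 * n) ^ d := Nat.mul_pos hn (by positivity)
    have h₃ : n * (n + 2) ^ d ≤ n * (3 * n) ^ d := Nat.mul_le_mul_left n h₁
    calc 2 * (n * (n + 2) ^ d) + 1 ≤ 3 * (n * (3 * n) ^ d) := by omega
      _ = _ := by rw [mul_pow]; ring
  have hfin : growthFunction S n ≤ (3 ^ (d + 1)) ^ r * 3 * n ^ ((d + 1) * r + 1) :=
    calc growthFunction S n ≤ (2 * (n * (n + 2) ^ d) + 1) ^ r * (2 * n + 1) := hcard ▸ hle
      _ ≤ (3 ^ (d + 1) * n ^ (d + 1)) ^ r * (3 * n) := by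
        gcongr
        omega
      _ = _ := by rw [mul_pow, ← pow_mul n]; ring
  exact_mod_cast hfin

/-- Use `t` and a basis of V as generators. Appending `t` or its inverse to `v * t ^ m` only shifts
m; appending a basis element or its inverse multiplies v by its conjugate under `t ^ m`, whose
coordinates are polynomial in |m|. As m takes both signs, both `t` and `t⁻¹` must be controlled. -/
theorem hasPolynomialGrowth_of_isPolyBounded {V : Subgroup G} [V.Normal] {r : ℕ}
    (e : Additive V ≃+ (Fin r → ℤ)) {t : G} (htop : ∀ g : G, ∃ (m : ℤ) (u : V), g = u * t ^ m)
    (hpos : ∀ (f : Additive V →+ ℂ) (v : V),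
      IsPolyBounded fun n => f (.ofMul (MulAut.conjNormal (t ^ n) v)))
    (hneg : ∀ (f : Additive V →+ ℂ) (v : V),
      IsPolyBounded fun n => f (.ofMul (MulAut.conjNormal (t⁻¹ ^ n) v))) :
    HasPolynomialGrowth G := by
  classical
  let b : Fin r → V := fun j => (e.symm (Pi.single j 1)).toMul
  let S : Finset G := insert t (Finset.univ.image fun j => (b j : G))
  have hVS : ∀ v : V, (v : G) ∈ Subgroup.closure (S : Set G) := by
    let K : AddSubgroup (Fin r → ℤ) :=
      (((Subgroup.closure (S : Set G)).comap V.subtype).toAddSubgroup).comap e.symm.toAddMonoidHom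
    have hsingle : ∀ j, (Pi.single j 1 : Fin r → ℤ) ∈ K := fun j =>
      Subgroup.subset_closure (show (b j : G) ∈ (S : Set G) by simp [S])
    have hK : ∀ x, x ∈ K := fun x => by
      rw [← Finset.univ_sum_single x]
      refine sum_mem fun i _ => ?_
      have : (Pi.single i (x i) : Fin r → ℤ) = x i • Pi.single i 1 := by simp [← Pi.single_smul]
      rw [this]
      exact zsmul_mem (hsingle i) _
    intro v
    have h := hK (e (.ofMul v))
    have h' : ((e.symm (e (.ofMul v))).toMul : G) ∈ Subgroup.closure (S : Set G) := h
    simpa using h'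
  have hS : Subgroup.closure (S : Set G) = ⊤ := by
    rw [eq_top_iff]
    intro g _
    obtain ⟨m, u, rfl⟩ := htop g
    exact mul_mem (hVS u) (zpow_mem (Subgroup.subset_closure (by simp [S])) m)
  have hbound : ∀ i j, ∃ d : ℕ, ∀ m : ℤ,
      (e (.ofMul (MulAut.conjNormal (t ^ m) (b j))) i).natAbs ≤ (m.natAbs + 2) ^ d := by
    intro i j
    let f : Additive V →+ ℂ :=
      (Int.castAddHom ℂ).comp ((Pi.evalAddMonoidHom _ i).comp e.toAddMonoidHom)
    have hf : ∀ v, ‖f v‖ = ((e v i).natAbs : ℝ) := fun v => by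
      have : f v = ((e v i : ℤ) : ℂ) := rfl
      rw [this, Complex.norm_intCast, Nat.cast_natAbs, Int.cast_abs]
    obtain ⟨d₁, h₁⟩ := hpos f (b j)
    obtain ⟨d₂, h₂⟩ := hneg f (b j)
    refine ⟨max d₁ d₂, fun m => ?_⟩
    obtain ⟨n, rfl | rfl⟩ := m.eq_nat_or_neg
    · have := (h₁ n).trans (pow_le_pow_of_le_exponent n (le_max_left d₁ d₂))
      rw [hf] at this
      rw [zpow_natCast, Int.natAbs_natCast]
      exact_mod_cast this
    · have := (h₂ n).trans (pow_le_pow_of_le_exponent n (le_max_right d₁ d₂))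
      rw [hf] at this
      rw [zpow_neg, zpow_natCast, ← inv_pow, Int.natAbs_neg, Int.natAbs_natCast]
      exact_mod_cast this
  choose D hD using hbound
  let d : ℕ := Finset.univ.sup fun i => Finset.univ.sup (D i)
  have hd : ∀ i j (m : ℤ), (e (.ofMul (MulAut.conjNormal (t ^ m) (b j))) i).natAbs ≤
      (m.natAbs + 2) ^ d := fun i j m =>
    (hD i j m).trans (Nat.pow_le_pow_right (by omega)
      ((Finset.le_sup (f := D i) (Finset.mem_univ j)).trans
        (Finset.le_sup (f := fun i => Finset.univ.sup (D i)) (Finset.mem_univ i))))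
  refine hasPolynomialGrowth_of_coordinates e (t := t) hS d fun l => ?_
  -- Letters are added on the right, where the normal form `v * t ^ m` absorbs them; each adds at
  -- most (length + 2)^d to a coordinate.
  induction l using List.reverseRecOn with
  | nil => exact fun _ => ⟨1, 0, by simp, by simp, by simp⟩
  | append_singleton l s ih =>
    intro hl
    obtain ⟨v, m, hvm, hm, hv⟩ := ih fun x hx => hl x (by simp [hx])
    have hlen : (l ++ [s]).length = l.length + 1 := by simp
    have hprod : (l ++ [s]).prod = v * t ^ m * s := by simp [hvm]
    have hmono : (l.length + 2) ^ d ≤ (l.length + 1 + 2) ^ d := Nat.pow_le_pow_left (by omega) d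
    have hmono' : l.length * (l.length + 2) ^ d ≤ l.length * (l.length + 1 + 2) ^ d :=
      Nat.mul_le_mul_left _ hmono
    have hstay : ∀ k : ℤ, s = t ^ k → k.natAbs ≤ 1 → ∃ (v : V) (m : ℤ),
        (l ++ [s]).prod = v * t ^ m ∧ m.natAbs ≤ (l ++ [s]).length ∧ ∀ i,
          (e (.ofMul v) i).natAbs ≤ (l ++ [s]).length * ((l ++ [s]).length + 2) ^ d := by
      intro k hk hk1
      refine ⟨v, m + k, by rw [hprod, hk, zpow_add, mul_assoc], by omega, fun i => ?_⟩
      rw [hlen, Nat.add_mul]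
      have := hv i
      omega
    have hmove : ∀ w : V, s = w → (∀ i,
        (e (.ofMul (MulAut.conjNormal (t ^ m) w)) i).natAbs ≤ (m.natAbs + 2) ^ d) →
        ∃ (v : V) (m : ℤ), (l ++ [s]).prod = v * t ^ m ∧ m.natAbs ≤ (l ++ [s]).length ∧ ∀ i,
          (e (.ofMul v) i).natAbs ≤ (l ++ [s]).length * ((l ++ [s]).length + 2) ^ d := by
      intro w hw hwd
      refine ⟨v * MulAut.conjNormal (t ^ m) w, m, ?_, by omega, fun i => ?_⟩
      · rw [hprod, hw, Subgroup.coe_mul, MulAut.conjNormal_apply]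
        group
      · rw [ofMul_mul, map_add, Pi.add_apply, hlen, Nat.add_mul, one_mul]
        have h₁ := hv i
        have h₂ := (hwd i).trans (Nat.pow_le_pow_left (Nat.add_le_add_right hm 2) d)
        have h₃ := Int.natAbs_add_le (e (.ofMul v) i)
          (e (.ofMul (MulAut.conjNormal (t ^ m) w)) i)
        omega
    rcases hl s (by simp) with hs | hs
    · rcases Finset.mem_insert.1 hs with rfl | hs
      · exact hstay 1 (by simp) (by simp)
      · obtain ⟨j, -, rfl⟩ := Finset.mem_image.1 hs
        exact hmove (b j) rfl fun i => hd i j m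
    · rcases Finset.mem_insert.1 hs with hs | hs
      · exact hstay (-1) (by simp [← hs]) (by simp)
      · obtain ⟨j, -, hj⟩ := Finset.mem_image.1 hs
        refine hmove (b j)⁻¹ (by simp [hj]) fun i => ?_
        rw [map_inv, ofMul_inv, map_neg, Pi.neg_apply, Int.natAbs_neg]
        exact hd i j m

/-- The characters with an expanding eigenvalue force uniform exponential growth. -/
theorem hasUniformExponentialGrowth_of_hasEigenvalue [Group.FG G] {V : Subgroup G} [V.Normal]
    [IsMulCommutative V] {t : G} {c : ℂ} (ht : (conjEnd V t).HasEigenvalue c) (hc : 1 < ‖c‖)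
    (htop : ∀ g : G, ∃ (m : ℤ) (u : V), g = u * t ^ m) : HasUniformExponentialGrowth G := by
  obtain ⟨f, hf⟩ := ht.exists_hasEigenvector
  refine hasUniformExponentialGrowth_of_multiplier hf.2 (fun v => ?_) hc htop
  rw [← conjEnd_apply, hf.apply_eq_smul]
  rfl

end GroupGrowth

theorem theorem3p5 (Γ : Type*) [Group Γ] [Group.FG Γ] (V : Subgroup Γ) [V.Normal] (r : ℕ)
    (hV : Nonempty (V ≃* Multiplicative (Fin r → ℤ))) (hcyc : IsCyclic (Γ ⧸ V)) :
    (GroupGrowth.HasPolynomialGrowth Γ ∨ GroupGrowth.HasUniformExponentialGrowth Γ) ∧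
      ¬ (GroupGrowth.HasPolynomialGrowth Γ ∧ GroupGrowth.HasUniformExponentialGrowth Γ) := by
  refine ⟨?_, fun h => h.1.not_hasUniformExponentialGrowth h.2⟩
  obtain ⟨e'⟩ := hV
  let e : Additive V ≃+ (Fin r → ℤ) := MulEquiv.toAdditiveLeft e'
  have : IsMulCommutative V := IsMulCommutative.of_comm fun a b => e'.injective (by
    rw [map_mul, map_mul, mul_comm])
  have := GroupGrowth.finiteDimensional_characters e
  obtain ⟨q, hq⟩ := hcyc.exists_generator
  obtain ⟨t, rfl⟩ := QuotientGroup.mk_surjective q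
  have htop : ∀ g : Γ, ∃ (m : ℤ) (u : V), g = u * t ^ m := by
    intro g
    obtain ⟨m, hm⟩ := Subgroup.mem_zpowers_iff.1 (hq g)
    refine ⟨m, ⟨g * (t ^ m)⁻¹, ?_⟩, by simp⟩
    rw [← QuotientGroup.eq_one_iff, QuotientGroup.mk_mul, QuotientGroup.mk_inv,
      QuotientGroup.mk_zpow, hm, mul_inv_cancel]
  have htop' : ∀ g : Γ, ∃ (m : ℤ) (u : V), g = u * t⁻¹ ^ m := fun g => by
    obtain ⟨m, u, h⟩ := htop g
    exact ⟨-m, u, by simpa using h⟩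
  -- The two operators are mutually inverse, so the two conditions together say that all eigenvalues
  -- have modulus 1.
  by_cases h₁ : ∀ c, (GroupGrowth.conjEnd V t).HasEigenvalue c → ‖c‖ ≤ 1
  · by_cases h₂ : ∀ c, (GroupGrowth.conjEnd V t⁻¹).HasEigenvalue c → ‖c‖ ≤ 1
    · exact .inl (GroupGrowth.hasPolynomialGrowth_of_isPolyBounded e htop
        (GroupGrowth.isPolyBounded_conj h₁) (GroupGrowth.isPolyBounded_conj h₂))
    · push Not at h₂
      obtain ⟨c, hc, hc1⟩ := h₂
      exact .inr (GroupGrowth.hasUniformExponentialGrowth_of_hasEigenvalue hc hc1 htop')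
  · push Not at h₁
    obtain ⟨c, hc, hc1⟩ := h₁
    exact .inr (GroupGrowth.hasUniformExponentialGrowth_of_hasEigenvalue hc hc1 htop)
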